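/- **Setting.** Let $I$ be a multi-agent path finding instance on a finite 4-neighbor grid map (a finite set of free cells of $\mathbb Z^2$) with a finite set of agents, each with a start and a goal. In each timestep an agent waits or moves to an adjacent free cell; a path eventually rests at the goal for ever, and its cost is the first timestep from which it does. Fix $k\ge 0$. Agents $i\ne j$ have a $k$-delay vertex conflict $\langle i,j,v,t,\Delta\rangle$ ($0\le\Delta\le k$) if $i$ is at $v$ at time $t$ and $j$ is at $v$ at time $t+\Delta$. A solution is a choice of paths without $k$-delay vertex conflicts and without swaps of two agents (for $k\ge1$ a swap implies a vertex conflict). Optimal means least sum of individual costs. **Barriers.** For a vertex-time pair $p=(u,t)$ put $ot(p,v)=t+|v_x-u_x|+|v_y-u_y|$. For a segment $S$ of a grid line $L$ the step temporal barrier $B_{step}(S,p,w)$ blocks each $v\in S$ during $[ot(p,v),ot(p,v)+w]$ and each $v\in L$ at distance $d\in[1,\lfloor w/2\rfloor]$ from $S$ during $[ot(p,v),ot(p,v)+w-2d]$. Let $R$ be the rectangle with root corner $D$ and opposite corner $E$, with sides $S_1$ (row of $D$), $S_4$ (row of $E$), $S_2$ (column of $D$), $S_3$ (column of $E$), let $rt$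 be a root time and $0\le k_1,k_2\le k$, $l_1=\lfloor k_1/2\rfloor$, $l_2=\lfloor k_2/2\rfloor$. Let $p_1$ be $D$ shifted outwards by $l_1$ along the $y$-axis, at time $rt-l_1$, and $p_2$ be $D$ shifted outwards by $l_2$ along the $x$-axis, at time $rt-l_2$. With sides shifted outwards, the entrance and exit barriers are $B_{step}((S_1)_{l_1},p_1,k_2)$, $B_{step}((S_4)_{l_1},p_1,k_2)$ for the agent $a_1$ that crosses vertically and $B_{step}((S_2)_{l_2},p_2,k_1)$, $B_{step}((S_3)_{l_2},p_2,k_1)$ for the agent $a_2$ that crosses horizontally. **Algorithm.** $k$-CBS is a best-first search over constraint-tree nodes (a set of constraints and, for each agent, a cheapest path respecting them), ordered by the sum of individual costs plus an admissible heuristic value (possibly $0$). A node of least priority is returned if its paths have no conflict. Otherwise one of its conflicts is resolved by two branches, each adding constraints for one agent and replanning it (a branch in which it has no path is dropped); normally, $\langle i,j,v,t,\Delta\rangle$ is resolved by forbidding $v$ during $[t,t+k]$ to $i$ or to $j$, and a swap by forbidding the move to one of the two agents. K-CBSH-RM first tries to detect a rectangle from a vertex conflict at $v$ that the two agents enter in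 orthogonal directions $d_1,d_2$: with $B_i$, $A_i$ the earliest and latest vertices of the path of $a_i$ such that all moves between $B_i$ and $v$, respectively $v$ and $A_i$, are in the directions $d_1,d_2$, each coordinate of $D$ (of $E$) is the one of $B_1,B_2$ (of $A_1,A_2$) that is closer to $v$, and $rt$ is the minimum over $i$ of the first time at which $a_i$ visits $B_i$ plus the Manhattan distance from $B_i$ to $D$; shifted sides may not pass the start or the goal of the agent that crosses them. If for some $k_1,k_2\le k$ Condition 1 holds for both agents and both current paths traverse the exit barriers, the two branches impose the exit barrier on $a_1$ and on $a_2$, respectively, for some such $k_1,k_2$; otherwise the conflict is resolved in the normal way. Condition 1 and the exit barriers are used in one of two modes: * *full:* every path of the agent that respects the constraints of the node and traverses its exit barrier also traverses its entrance barrier; the whole exit barrier is imposed; * *$k$-MDD:* in the $k$-MDD of the agent (the layered graph formed, on the levels $0,\dots,c+k$, by all its paths that respect the constraints of the node and cost at most $c+k$, $c$ being the least such cost), no vertex-time pair of the exit barrier is reachable from the start once the pairs of the entrance barrier are removed; the exit barrier imposed consists of its vertex-time pairs that are nodes of the $k$-MDD. **Theorem 2.** K-CBSH-RM is correct, in either mode.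 That is: (1) at every node, every solution that respects the constraints of the node respects those of at least one of its two branches, and the constraints added in each branch are violated by the current path of the agent concerned; (2) whatever the search returns is an optimal solution; (3) if the instance is solvable, then, whatever choices are made, the search ends after finitely many iterations by returning a solution. Moreover (1) holds for rectangle branching with arbitrary $R$, $rt$ and $k_1,k_2\le k$ (Condition 1 and the traversal of the exit barriers by the current paths being required), and (2), (3) hold for every rule of choosing among these and the normal resolutions. -/

import Mathlib

namespace KRobust

/-! ### Grid maps, instances, paths, plans -/

/-- A location of the 4-neighbor grid. -/
abbrev Cell := ℤ × ℤ

/-- Manhattan distance. -/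
def manh (u v : Cell) : ℤ := |v.1 - u.1| + |v.2 - u.2|

/-- A multi-agent path finding instance on a finite 4-neighbor grid map; `cells` are the traversable
locations and `ι` is the set of agents. -/
structure Instance (ι : Type*) where
  cells : Finset Cell
  start : ι → Cell
  goal : ι → Cell
  start_mem : ∀ i, start i ∈ cells
  goal_mem : ∀ i, goal i ∈ cells

variable {ι : Type*}

/-- A path of agent `i`: at each timestep the agent waits or moves to an adjacent free cell, and from
some timestep on it rests at its goal for ever. -/
structure IsPath (I : Instance ι) (i : ι) (p : ℕ → Cell) : Prop where
  start : p 0 = I.start i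
  mem : ∀ t, p t ∈ I.cells
  step : ∀ t, p (t + 1) = p t ∨ manh (p t) (p (t + 1)) = 1
  rest : ∃ T, ∀ t, T ≤ t → p t = I.goal i

/-- Cost (length) of a path: the first timestep from which the agent rests at its goal. -/
noncomputable def cost (I : Instance ι) (i : ι) (p : ℕ → Cell) : ℕ :=
  sInf {T | ∀ t, T ≤ t → p t = I.goal i}

/-- Sum of individual costs. -/
noncomputable def sic [Fintype ι] (I : Instance ι) (π : ι → ℕ → Cell) : ℕ :=
  ∑ i, cost I i (π i)

/-- The `k`-delay vertex conflict `⟨i, j, v, t, Δ⟩`: agent `i` is at `v` at timestep `t` and agent `j`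
is at `v` at timestep `t + Δ`, where `Δ ≤ k`. -/
def VertexConflict (k : ℕ) (π : ι → ℕ → Cell) (i j : ι) (v : Cell) (t Δ : ℕ) : Prop :=
  i ≠ j ∧ Δ ≤ k ∧ π i t = v ∧ π j (t + Δ) = v

/-- The agents `i` and `j` swap their locations `u` and `v` between timesteps `t` and `t + 1`.
(For `k ≥ 1` a swap always comes with a `k`-delay vertex conflict.) -/
def SwapConflict (π : ι → ℕ → Cell) (i j : ι) (u v : Cell) (t : ℕ) : Prop :=
  i ≠ j ∧ u ≠ v ∧ π i t = u ∧ π i (t + 1) = v ∧ π j t = v ∧ π j (t + 1) = u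

/-- The plan `π` has some conflict. -/
def Conflicted (k : ℕ) (π : ι → ℕ → Cell) : Prop :=
  (∃ i j v t Δ, VertexConflict k π i j v t Δ) ∨ (∃ i j u v t, SwapConflict π i j u v t)

/-- A solution of the `k`-robust problem. -/
def IsSolution (I : Instance ι) (k : ℕ) (π : ι → ℕ → Cell) : Prop :=
  (∀ i, IsPath I i (π i)) ∧ ¬ Conflicted k π

/-! ### Constraints -/

/-- Elementary constraints: `at_ a v t` forbids agent `a` to be at `v` at timestep `t`, and
`move a u v t` forbids it to move from `u` to `v` between timesteps `t` and `t + 1`. -/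
inductive Constraint (ι : Type*) where
  | at_ (a : ι) (v : Cell) (t : ℤ) : Constraint ι
  | move (a : ι) (u v : Cell) (t : ℕ) : Constraint ι

/-- The path `p` of agent `i` violates some constraint of `C`. -/
def Violates (C : Set (Constraint ι)) (i : ι) (p : ℕ → Cell) : Prop :=
  (∃ t : ℕ, Constraint.at_ i (p t) (t : ℤ) ∈ C) ∨
    (∃ t : ℕ, Constraint.move i (p t) (p (t + 1)) t ∈ C)

/-- `p` is a path of agent `i` that respects all the constraints of `C`. -/
def Consistent (I : Instance ι) (C : Set (Constraint ι)) (i : ι) (p : ℕ → Cell) : Prop :=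
  IsPath I i p ∧ ¬ Violates C i p

/-- `p` is a cheapest path of agent `i` among those that respect `C` (a possible answer of the
low-level search). -/
def IsOptPath (I : Instance ι) (C : Set (Constraint ι)) (i : ι) (p : ℕ → Cell) : Prop :=
  Consistent I C i p ∧ ∀ q, Consistent I C i q → cost I i p ≤ cost I i q

/-- A set of vertex-time pairs, each to be avoided by some agent. -/
abbrev Barrier := Set (Cell × ℤ)

/-- The constraints that forbid agent `a` every vertex-time pair of the barrier `B`. -/
def forbid (a : ι) (B : Barrier) : Set (Constraint ι) :=
  {c | ∃ x ∈ B, c = Constraint.at_ a x.1 x.2}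

/-- The time-range constraint: vertex `v` during the timesteps `lo, …, hi`. -/
def range (v : Cell) (lo hi : ℤ) : Barrier := {x | x.1 = v ∧ lo ≤ x.2 ∧ x.2 ≤ hi}

/-- A path traverses a barrier if it visits one of its vertices at a time at which it is blocked. -/
def Traverses (p : ℕ → Cell) (B : Barrier) : Prop := ∃ t : ℕ, (p t, (t : ℤ)) ∈ B

/-! ### Temporal barriers and step temporal barriers -/

/-- Optimal time to reach `v` from the vertex-time pair `p`. -/
def ot (p : Cell × ℤ) (v : Cell) : ℤ := p.2 + manh p.1 v

/-- The `w` temporal barrier `B(·, V, p, w)`. -/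
def temporalBarrier (V : Set Cell) (p : Cell × ℤ) (w : ℤ) : Barrier :=
  ⋃ v ∈ V, range v (ot p v) (ot p v + w)

/-- `d` is the (Manhattan) distance from `v` to the set `S`. -/
def IsDist (v : Cell) (S : Set Cell) (d : ℤ) : Prop := IsLeast ((fun u => manh u v) '' S) d

/-- The step temporal barrier `B_step(·, S, p, k')`, where `S` is a segment of the line `L`: the
`k'` temporal barrier on `S`, together with the vertices of `L` at distance `d` from `S`,
`1 ≤ d ≤ ⌊k' / 2⌋`, each blocked during `[ot(p,v), ot(p,v) + k' - 2 d]`. -/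
def stepBarrier (L S : Set Cell) (p : Cell × ℤ) (k' : ℕ) : Barrier :=
  temporalBarrier S p k' ∪
    {x | x.1 ∈ L ∧ ∃ d : ℕ, 1 ≤ d ∧ d ≤ k' / 2 ∧ IsDist x.1 S d ∧
      x ∈ range x.1 (ot p x.1) (ot p x.1 + k' - 2 * d)}

/-- The horizontal line in row `y`, and a segment of it. -/
def hLine (y : ℤ) : Set Cell := {v | v.2 = y}
def hSide (x₁ x₂ y : ℤ) : Set Cell := {v | v.1 ∈ Set.uIcc x₁ x₂ ∧ v.2 = y}

/-- The vertical line in column `x`, and a segment of it. -/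
def vLine (x : ℤ) : Set Cell := {v | v.1 = x}
def vSide (x y₁ y₂ : ℤ) : Set Cell := {v | v.1 = x ∧ v.2 ∈ Set.uIcc y₁ y₂}

/-- A rooted rectangle with root corner `D` and opposite corner `E`. The signs `sx`, `sy` give the
orientation from `D` to `E` in either coordinate (they are determined by `D` and `E` unless the
rectangle is degenerate). -/
structure RootedRect where
  D : Cell
  E : Cell
  sx : ℤ
  sy : ℤ
  hsx : sx = 1 ∨ sx = -1
  hsy : sy = 1 ∨ sy = -1
  hx : 0 ≤ sx * (E.1 - D.1)
  hy : 0 ≤ sy * (E.2 - D.2)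

namespace RootedRect

/-- The sides `S1, S4` (rows) and `S2, S3` (columns), shifted by `l` away from the rectangle:
these are the coordinates of the four lines. -/
def row₁ (R : RootedRect) (l : ℤ) : ℤ := R.D.2 - R.sy * l
def row₄ (R : RootedRect) (l : ℤ) : ℤ := R.E.2 + R.sy * l
def col₂ (R : RootedRect) (l : ℤ) : ℤ := R.D.1 - R.sx * l
def col₃ (R : RootedRect) (l : ℤ) : ℤ := R.E.1 + R.sx * l

/-- The pair `p₁ = (D shifted by l₁ along the y-axis, rt - l₁)`. -/
def p₁ (R : RootedRect) (rt l₁ : ℤ) : Cell × ℤ := ((R.D.1, R.row₁ l₁), rt - l₁)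

/-- The pair `p₂ = (D shifted by l₂ along the x-axis, rt - l₂)`. -/
def p₂ (R : RootedRect) (rt l₂ : ℤ) : Cell × ℤ := ((R.col₂ l₂, R.D.2), rt - l₂)

/-- Entrance and exit of the agent that crosses from `S1` to `S4`; here `l₁ = ⌊k₁ / 2⌋`. -/
def entrance₁ (R : RootedRect) (rt : ℤ) (k₁ k₂ : ℕ) : Barrier :=
  stepBarrier (hLine (R.row₁ (k₁ / 2 : ℕ))) (hSide R.D.1 R.E.1 (R.row₁ (k₁ / 2 : ℕ)))
    (R.p₁ rt (k₁ / 2 : ℕ)) k₂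
def exit₁ (R : RootedRect) (rt : ℤ) (k₁ k₂ : ℕ) : Barrier :=
  stepBarrier (hLine (R.row₄ (k₁ / 2 : ℕ))) (hSide R.D.1 R.E.1 (R.row₄ (k₁ / 2 : ℕ)))
    (R.p₁ rt (k₁ / 2 : ℕ)) k₂

/-- Entrance and exit of the agent that crosses from `S2` to `S3`; here `l₂ = ⌊k₂ / 2⌋`. -/
def entrance₂ (R : RootedRect) (rt : ℤ) (k₁ k₂ : ℕ) : Barrier :=
  stepBarrier (vLine (R.col₂ (k₂ / 2 : ℕ))) (vSide (R.col₂ (k₂ / 2 : ℕ)) R.D.2 R.E.2)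
    (R.p₂ rt (k₂ / 2 : ℕ)) k₁
def exit₂ (R : RootedRect) (rt : ℤ) (k₁ k₂ : ℕ) : Barrier :=
  stepBarrier (vLine (R.col₃ (k₂ / 2 : ℕ))) (vSide (R.col₃ (k₂ / 2 : ℕ)) R.D.2 R.E.2)
    (R.p₂ rt (k₂ / 2 : ℕ)) k₁

end RootedRect

/-! ### Nodes of the constraint tree, `k`-MDDs, Condition 1 -/

/-- A node of the constraint tree: its constraints and its current paths. -/
structure Node (ι : Type*) where
  cons : Set (Constraint ι)
  paths : ι → ℕ → Cell

/-- Every current path is an optimal path under the constraints of the node. -/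
def Node.Wf (I : Instance ι) (N : Node ι) : Prop :=
  ∀ i, IsOptPath I N.cons i (N.paths i)

/-- The solution `π` respects the constraints of the set `C`. -/
def Permits (C : Set (Constraint ι)) (π : ι → ℕ → Cell) : Prop := ∀ i, ¬ Violates C i (π i)

/-- The number of the last level of the `k`-MDD of agent `i` at the node `N`: the cost of an optimal
path under the constraints of `N`, plus `k`. -/
noncomputable def mddDepth (I : Instance ι) (k : ℕ) (N : Node ι) (i : ι) : ℕ :=
  cost I i (N.paths i) + k

/-- The paths stored in the `k`-MDD: the paths of agent `i` that respect the constraints of the node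
and cost at most `k` more than an optimal one. -/
def MddPath (I : Instance ι) (k : ℕ) (N : Node ι) (i : ι) (p : ℕ → Cell) : Prop :=
  Consistent I N.cons i p ∧ cost I i p ≤ mddDepth I k N i

/-- The nodes of the `k`-MDD: `v` at level `t`. -/
def MddNode (I : Instance ι) (k : ℕ) (N : Node ι) (i : ι) (v : Cell) (t : ℕ) : Prop :=
  t ≤ mddDepth I k N i ∧ ∃ p, MddPath I k N i p ∧ p t = v

/-- The edges of the `k`-MDD: from `u` at level `t` to `v` at level `t + 1`. -/
def MddEdge (I : Instance ι) (k : ℕ) (N : Node ι) (i : ι) (u v : Cell) (t : ℕ) : Prop :=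
  t + 1 ≤ mddDepth I k N i ∧ ∃ p, MddPath I k N i p ∧ p t = u ∧ p (t + 1) = v

/-- Reachability from the source of the `k`-MDD while the pairs in `block` are blocked. -/
inductive MddReach (I : Instance ι) (k : ℕ) (N : Node ι) (i : ι) (block : Barrier) :
    Cell → ℕ → Prop
  | source : MddNode I k N i (I.start i) 0 → (I.start i, (0 : ℤ)) ∉ block →
      MddReach I k N i block (I.start i) 0
  | next {u v : Cell} {t : ℕ} : MddReach I k N i block u t → MddEdge I k N i u v t →
      (v, ((t + 1 : ℕ) : ℤ)) ∉ block → MddReach I k N i block v (t + 1)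

/-- The two ways of using a pair of barriers. `full`: Condition 1 is required of all possible paths of
the agent, and the whole exit barrier is imposed. `mdd`: Condition 1 is checked in the `k`-MDD, and
the exit barrier consists of those of its vertex-time pairs that are nodes of the `k`-MDD. -/
inductive Mode where
  | full
  | mdd

/-- The exit barrier that is imposed on agent `i`. -/
def usedExit (I : Instance ι) (k : ℕ) (N : Node ι) (i : ι) (ex : Barrier) : Mode → Barrier
  | .full => ex
  | .mdd => {x | x ∈ ex ∧ ∃ t : ℕ, x.2 = (t : ℤ) ∧ MddNode I k N i x.1 t}

/-- Condition 1 for agent `i`: what traverses the exit must traverse the entrance. In the `k`-MDD: no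
pair of the exit barrier is reachable once the entrance barrier is blocked. -/
def Condition1 (I : Instance ι) (k : ℕ) (N : Node ι) (i : ι) (en ex : Barrier) : Mode → Prop
  | .full => ∀ p, Consistent I N.cons i p → Traverses p ex → Traverses p en
  | .mdd => ∀ (v : Cell) (t : ℕ), (v, (t : ℤ)) ∈ ex → ¬ MddReach I k N i en v t

/-! ### Resolving conflicts -/

/-- The ways to resolve a conflict: by the two range constraints for a vertex conflict, by two move
constraints for a swap, or by the two exit barriers of a rectangle, where agent `a` crosses from
`S1` to `S4` and agent `b` from `S2` to `S3`. -/
inductive Resolution (ι : Type*) where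
  | vertex (i j : ι) (v : Cell) (t Δ : ℕ) : Resolution ι
  | swap (i j : ι) (u v : Cell) (t : ℕ) : Resolution ι
  | rect (mode : Mode) (a b : ι) (R : RootedRect) (rt : ℤ) (k₁ k₂ : ℕ) : Resolution ι

/-- When a resolution may be used at the node `N`. For a rectangle: both agents satisfy Condition 1,
and both current paths run into the exit barriers. -/
def Valid (I : Instance ι) (k : ℕ) (N : Node ι) : Resolution ι → Prop
  | .vertex i j v t Δ => VertexConflict k N.paths i j v t Δ
  | .swap i j u v t => SwapConflict N.paths i j u v t
  | .rect mode a b R rt k₁ k₂ =>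
      a ≠ b ∧ k₁ ≤ k ∧ k₂ ≤ k ∧
      Condition1 I k N a (R.entrance₁ rt k₁ k₂) (R.exit₁ rt k₁ k₂) mode ∧
      Condition1 I k N b (R.entrance₂ rt k₁ k₂) (R.exit₂ rt k₁ k₂) mode ∧
      Traverses (N.paths a) (usedExit I k N a (R.exit₁ rt k₁ k₂) mode) ∧
      Traverses (N.paths b) (usedExit I k N b (R.exit₂ rt k₁ k₂) mode)

/-- The two branches: in each one, an agent and the constraints that are added for it. -/
def branches (I : Instance ι) (k : ℕ) (N : Node ι) :
    Resolution ι → (ι × Set (Constraint ι)) × (ι × Set (Constraint ι))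
  | .vertex i j v t _ => ((i, forbid i (range v t (t + k))), (j, forbid j (range v t (t + k))))
  | .swap i j u v t => ((i, {Constraint.move i u v t}), (j, {Constraint.move j v u t}))
  | .rect mode a b R rt k₁ k₂ =>
      ((a, forbid a (usedExit I k N a (R.exit₁ rt k₁ k₂) mode)),
        (b, forbid b (usedExit I k N b (R.exit₂ rt k₁ k₂) mode)))

/-! ### Detecting rectangles -/

/-- The agent that is at `p t` at timestep `t` entered this vertex by a move in direction `d`. -/
def EnteredBy (p : ℕ → Cell) (t : ℕ) (d : Cell) : Prop :=
  ∃ s, s < t ∧ p s + d = p t ∧ ∀ r, s < r → r ≤ t → p r = p t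

/-- All moves between the timesteps `s` and `t` are in direction `(sx, 0)` or `(0, sy)`. -/
def MovesIn (sx sy : ℤ) (p : ℕ → Cell) (s t : ℕ) : Prop :=
  ∀ r, s ≤ r → r < t →
    p (r + 1) = p r ∨ p (r + 1) = p r + (sx, 0) ∨ p (r + 1) = p r + (0, sy)

/-- `B` is the earliest vertex of `p` from which all moves up to timestep `t` are in the two
directions. -/
def IsEarliest (sx sy : ℤ) (p : ℕ → Cell) (t : ℕ) (B : Cell) : Prop :=
  ∃ s, s ≤ t ∧ p s = B ∧ MovesIn sx sy p s t ∧ ∀ s', s' ≤ t → MovesIn sx sy p s' t → s ≤ s'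

/-- `A` is the latest vertex of `p` up to which all moves from timestep `t` on are in the two
directions. -/
def IsLatest (sx sy : ℤ) (p : ℕ → Cell) (t : ℕ) (A : Cell) : Prop :=
  ∃ s, t ≤ s ∧ p s = A ∧ MovesIn sx sy p t s ∧ ∀ s', s ≤ s' → MovesIn sx sy p t s' → p s' = A

/-- `z` is the closer of `x` and `y` to `c`. -/
def IsCloser (c x y z : ℤ) : Prop := (z = x ∨ z = y) ∧ |z - c| ≤ |x - c| ∧ |z - c| ≤ |y - c|

/-- The earliest timestep at which `p` visits `B`. -/
noncomputable def firstVisit (p : ℕ → Cell) (B : Cell) : ℕ := sInf {t | p t = B}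

/-- The rectangle `R` and the root time `rt` are those detected from the fact that the path `p` visits
`v` at timestep `tp`, entering it vertically, and the path `q` visits `v` at timestep `tq`, entering
it horizontally. -/
def Detects (p q : ℕ → Cell) (v : Cell) (tp tq : ℕ) (R : RootedRect) (rt : ℤ) : Prop :=
  p tp = v ∧ q tq = v ∧ EnteredBy p tp (0, R.sy) ∧ EnteredBy q tq (R.sx, 0) ∧
  ∃ Bp Bq Ap Aq : Cell,
    IsEarliest R.sx R.sy p tp Bp ∧ IsEarliest R.sx R.sy q tq Bq ∧
    IsLatest R.sx R.sy p tp Ap ∧ IsLatest R.sx R.sy q tq Aq ∧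
    IsCloser v.1 Bp.1 Bq.1 R.D.1 ∧ IsCloser v.2 Bp.2 Bq.2 R.D.2 ∧
    IsCloser v.1 Ap.1 Aq.1 R.E.1 ∧ IsCloser v.2 Ap.2 Aq.2 R.E.2 ∧
    rt = min (firstVisit p Bp + manh Bp R.D) (firstVisit q Bq + manh Bq R.D)

/-- Along an axis, oriented by the sign `s`, shifting the entrance from `D` and the exit from `E` by
`l` outwards does not take them beyond the start `st` or the goal `g`. -/
def ShiftOk (s D E l st g : ℤ) : Prop :=
  (s * st ≤ s * D → s * st ≤ s * D - l) ∧ (s * E ≤ s * g → s * E + l ≤ s * g)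

/-- Agents `a` (entering vertically) and `b` (entering horizontally) have a `k`-delay vertex conflict,
given by `c = (i, j, v, t, Δ)`, from which the rectangle `R` and the root time `rt` are detected, and
the shifts for `k₁`, `k₂` are permitted. -/
def RectOf (I : Instance ι) (N : Node ι) (i j : ι) (v : Cell) (t Δ : ℕ)
    (a b : ι) (R : RootedRect) (rt : ℤ) (k₁ k₂ : ℕ) : Prop :=
  ((a = i ∧ b = j ∧ Detects (N.paths i) (N.paths j) v t (t + Δ) R rt) ∨
    (a = j ∧ b = i ∧ Detects (N.paths j) (N.paths i) v (t + Δ) t R rt)) ∧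
  ShiftOk R.sy R.D.2 R.E.2 (k₁ / 2 : ℕ) (I.start a).2 (I.goal a).2 ∧
  ShiftOk R.sx R.D.1 R.E.1 (k₂ / 2 : ℕ) (I.start b).1 (I.goal b).1

/-- The rule of K-CBSH-RM: a vertex conflict is resolved by a rectangle detected from it whenever
there are `k₁, k₂` for which this is valid, and in the normal way otherwise. -/
def rmRule (I : Instance ι) (k : ℕ) (mode : Mode) (N : Node ι) : Resolution ι → Prop
  | .vertex i j v t Δ => ¬ ∃ a b R rt k₁ k₂, RectOf I N i j v t Δ a b R rt k₁ k₂ ∧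
      Valid I k N (.rect mode a b R rt k₁ k₂)
  | .swap _ _ _ _ _ => True
  | .rect mode' a b R rt k₁ k₂ => mode' = mode ∧ ∃ i j v t Δ,
      VertexConflict k N.paths i j v t Δ ∧ RectOf I N i j v t Δ a b R rt k₁ k₂

/-! ### The search -/

/-- The outcome `S` (at most one node) of replanning agent `a` after adding the constraints `C`. -/
def Child (I : Instance ι) (N : Node ι) (a : ι) (C : Set (Constraint ι))
    (S : Multiset (Node ι)) : Prop :=
  (∃ N' : Node ι, S = {N'} ∧ N'.cons = N.cons ∪ C ∧ (∀ i, i ≠ a → N'.paths i = N.paths i) ∧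
      IsOptPath I (N.cons ∪ C) a (N'.paths a)) ∨
    (S = 0 ∧ ∀ p, ¬ Consistent I (N.cons ∪ C) a p)

/-- The initial OPEN list: the root without constraints, or nothing if some agent has no path. -/
def Init (I : Instance ι) (S : Multiset (Node ι)) : Prop :=
  (∃ N : Node ι, S = {N} ∧ N.cons = ∅ ∧ N.Wf I) ∨ (S = 0 ∧ ∃ i, ∀ p, ¬ IsPath I i p)

section Search

variable [Fintype ι]

/-- Priority of a node: the cost of its paths plus the heuristic value (`h = 0` for plain `k`-CBS). -/
noncomputable def prio (I : Instance ι) (h : Node ι → ℕ) (N : Node ι) : ℕ :=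
  sic I N.paths + h N

/-- An admissible high-level heuristic. -/
def Admissible (I : Instance ι) (k : ℕ) (h : Node ι → ℕ) : Prop :=
  ∀ N : Node ι, N.Wf I → ∀ π, IsSolution I k π → Permits N.cons π → prio I h N ≤ sic I π

/-- `N` is a node of minimal priority in OPEN. -/
def IsMin (I : Instance ι) (h : Node ι → ℕ) (S : Multiset (Node ι)) (N : Node ι) : Prop :=
  N ∈ S ∧ ∀ M ∈ S, prio I h N ≤ prio I h M

/-- The search ends with OPEN list `S` by returning the paths of the node `N`. -/
def Returns (I : Instance ι) (k : ℕ) (h : Node ι → ℕ) (S : Multiset (Node ι)) (N : Node ι) : Prop :=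
  IsMin I h S N ∧ ¬ Conflicted k N.paths

/-- One iteration of the high-level best-first search: a node of minimal priority, which has
conflicts, is replaced by its children for a valid resolution that conforms to the rule. -/
def Step (I : Instance ι) (k : ℕ) (h : Node ι → ℕ) (rule : Node ι → Resolution ι → Prop)
    (S S' : Multiset (Node ι)) : Prop :=
  ∃ N T r S₁ S₂, S = N ::ₘ T ∧ IsMin I h S N ∧ Conflicted k N.paths ∧
    Valid I k N r ∧ rule N r ∧
    Child I N (branches I k N r).1.1 (branches I k N r).1.2 S₁ ∧
    Child I N (branches I k N r).2.1 (branches I k N r).2.2 S₂ ∧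
    S' = S₁ + S₂ + T

/-- The search is sound, optimal and complete: whatever it returns is an optimal solution; it never
fails on a solvable instance; and on a solvable instance, every run comes to an end after finitely
many iterations by returning an (optimal) solution, that is, the run cannot go on for ever, and it
cannot stop in any other way. -/
def SearchCorrect (I : Instance ι) (k : ℕ) (h : Node ι → ℕ)
    (rule : Node ι → Resolution ι → Prop) : Prop :=
  (∃ S₀, Init I S₀) ∧
  ∀ S₀, Init I S₀ →
    (∀ S, Relation.ReflTransGen (Step I k h rule) S₀ S → ∀ N, Returns I k h S N →
      IsSolution I k N.paths ∧ ∀ π, IsSolution I k π → sic I N.paths ≤ sic I π) ∧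
    ((∃ π, IsSolution I k π) →
      (∀ S, Relation.ReflTransGen (Step I k h rule) S₀ S →
        S ≠ 0 ∧ ((∃ N, Returns I k h S N) ∨ ∃ S', Step I k h rule S S')) ∧
      ¬ ∃ run : ℕ → Multiset (Node ι), run 0 = S₀ ∧ ∀ n, Step I k h rule (run n) (run (n + 1)))

end Search

end KRobust

/-! The heart of the matter is that two agents which both traverse their entrance and their exit
barrier of a rectangle must conflict; hence every solution avoids one of the two exits, and imposing
them in two branches loses nothing.

Take coordinates with the root corner as origin and the rectangle in the first quadrant, and let `δ
= t - rt - x - y` be the delay. A step takes one unit of time and at most one unit of distance, so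
`t ± x ± y` never decreases along a walk. The barriers of the vertical agent are shaped so that `0 ≤
δ ≤ k₂` and `0 ≤ δ + 2x ≤ k₂ + 2 * width` on the entrance and on the exit. Both quantities are
monotone in time, so the bounds persist between the two visits, and `x` stays between `-⌊k₂/2⌋` and
`width + ⌊k₂/2⌋`: precisely the columns of the shifted sides of the other agent. The same holds with
the axes exchanged. Two walks that cross a box in this way share a cell (`exists_common_cell`, by a
winding number argument), and there the delays lie in `[0, k₂]` and `[0, k₁]`, so the visits are at
most `max k₁ k₂ ≤ k` apart (`RootedRect.exists_common_visit`).

The `k`-MDD form of Condition 1 is reduced to this by splicing paths (`Condition1.traverses`).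

For the search, every solution stays permitted by some open node (`Covering`), so with an admissible
heuristic an expanded or returned node costs at most as much as any solution. Fixing a solution of
cost `B`, each expansion excludes the current path, one of the finitely many of cost at most `B`,
from either child; a potential then decreases (`Step.potential_lt`), and the search ends. -/

namespace KRobust

/-! ### Crossing lattice walks -/

/-- The signed number of crossings of the ray `{(x, -1/2) | 0 < x}` by the step from `p` to `q`. -/
def rayCrossing (p q : Cell) : ℤ :=
  if 0 < p.1 then (if 0 ≤ q.2 then 1 else 0) - (if 0 ≤ p.2 then 1 else 0) else 0

theorem manh_le_one_cases {u v : Cell} (h : manh u v ≤ 1) :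
    (v.1 = u.1 ∧ (v.2 = u.2 ∨ v.2 = u.2 + 1 ∨ v.2 = u.2 - 1)) ∨
      (v.2 = u.2 ∧ (v.1 = u.1 + 1 ∨ v.1 = u.1 - 1)) := by
  unfold manh at h
  have h₁ := abs_nonneg (v.1 - u.1)
  have h₂ := abs_nonneg (v.2 - u.2)
  rcases abs_cases (v.1 - u.1) with h₃ | h₃ <;> rcases abs_cases (v.2 - u.2) with h₄ | h₄ <;> omega

/-- Around a unit square of differences of two walks, none of which vanishes, the crossings of the
ray cancel. -/
theorem rayCrossing_square {p p' q q' : Cell} (hp : manh p p' ≤ 1) (hq : manh q q' ≤ 1)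
    (h₁ : p ≠ q) (h₂ : p' ≠ q) (h₃ : p ≠ q') (h₄ : p' ≠ q') :
    rayCrossing (p - q) (p' - q) + rayCrossing (p' - q) (p' - q') =
      rayCrossing (p - q) (p - q') + rayCrossing (p - q') (p' - q') := by
  obtain ⟨x, y⟩ := p
  obtain ⟨x', y'⟩ := p'
  obtain ⟨z, w⟩ := q
  obtain ⟨z', w'⟩ := q'
  simp only [ne_eq, Prod.mk.injEq] at h₁ h₂ h₃ h₄
  have hp := manh_le_one_cases hp
  have hq := manh_le_one_cases hq
  simp only at hp hq
  simp only [rayCrossing, Prod.mk_sub_mk]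
  -- Parallel steps telescope. Among unit squares, only the one spanned by `(0, -1)` and `(1, 0)`
  -- has unbalanced crossings, and the origin is one of its corners.
  rcases hp with ⟨rfl, rfl | rfl | rfl⟩ | ⟨rfl, rfl | rfl⟩ <;>
    rcases hq with ⟨rfl, rfl | rfl | rfl⟩ | ⟨rfl, rfl | rfl⟩ <;>
    (split_ifs <;> omega)

/-- If the walks were disjoint, the differences `P s - Q t` would form a grid of closed squares
avoiding the origin. Summing `rayCrossing_square` over the grid, the crossing number of `P - Q t`,
suitably corrected at its lower end, does not depend on `t`. It is 1 when `Q` is on the left of `P`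
and 0 when it is on the right. -/
theorem exists_common_cell_of_crossing {P Q : ℕ → Cell} {m n : ℕ} {x₀ x₁ y₀ y₁ : ℤ}
    (hP : ∀ s < m, manh (P s) (P (s + 1)) ≤ 1) (hQ : ∀ t < n, manh (Q t) (Q (t + 1)) ≤ 1)
    (hPx : ∀ s ≤ m, x₀ ≤ (P s).1 ∧ (P s).1 ≤ x₁) (hQy : ∀ t ≤ n, y₀ ≤ (Q t).2 ∧ (Q t).2 ≤ y₁)
    (hP₀ : (P 0).2 ≤ y₀) (hP₁ : y₁ ≤ (P m).2) (hQ₀ : (Q 0).1 ≤ x₀) (hQ₁ : x₁ ≤ (Q n).1) :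
    ∃ s ≤ m, ∃ t ≤ n, P s = Q t := by
  by_contra! hne
  have hne' : ∀ s ≤ m, ∀ t ≤ n, ¬ ((P s).1 = (Q t).1 ∧ (P s).2 = (Q t).2) :=
    fun s hs t ht h => hne s hs t ht (Prod.ext h.1 h.2)
  let N : ℕ → ℕ → ℤ := fun t j =>
    ∑ s ∈ Finset.range j, rayCrossing (P s - Q t) (P (s + 1) - Q t)
  -- Boundary correction: `P 0` may lie level with `Q t`, already on the upper side of the ray.
  let K : ℕ → ℤ := fun t => if 0 < (P 0 - Q t).1 ∧ 0 ≤ (P 0 - Q t).2 then 1 else 0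
  have strip : ∀ t < n, ∀ j ≤ m,
      N t j + rayCrossing (P j - Q t) (P j - Q (t + 1)) =
        rayCrossing (P 0 - Q t) (P 0 - Q (t + 1)) + N (t + 1) j := by
    intro t ht j
    induction j with
    | zero => intro _; simp [N]
    | succ j ih =>
      intro hj
      have e := ih (by omega)
      have sq := rayCrossing_square (hP j (by omega)) (hQ t ht) (hne j (by omega) t (by omega))
        (hne (j + 1) hj t (by omega)) (hne j (by omega) (t + 1) (by omega))
        (hne (j + 1) hj (t + 1) (by omega))
      simp only [N, Finset.sum_range_succ] at e ⊢
      linarith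
  have top : ∀ t < n, rayCrossing (P m - Q t) (P m - Q (t + 1)) = 0 := by
    intro t ht
    have h₁ := hQy t (by omega)
    have h₂ := hQy (t + 1) (by omega)
    simp only [rayCrossing, Prod.fst_sub, Prod.snd_sub]
    split_ifs <;> omega
  -- `P 0 - Q t` never lies above the axis. While it stays on the axis, its first coordinate cannot
  -- change sign without passing through the excluded origin.
  have bottom : ∀ t < n, rayCrossing (P 0 - Q t) (P 0 - Q (t + 1)) = K (t + 1) - K t := by
    intro t ht
    have h₁ := hQy t (by omega)
    have h₂ := hQy (t + 1) (by omega)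
    have h₃ := hne' 0 (by omega) t (by omega)
    have h₄ := hne' 0 (by omega) (t + 1) (by omega)
    have h₅ := manh_le_one_cases (hQ t ht)
    simp only [rayCrossing, K, Prod.fst_sub, Prod.snd_sub]
    split_ifs <;> omega
  have const : ∀ t ≤ n, N t m + K t = N 0 m + K 0 := by
    intro t
    induction t with
    | zero => intro _; rfl
    | succ t ih =>
      intro ht
      have e := strip t ht m le_rfl
      rw [top t ht, bottom t ht] at e
      have := ih (by omega)
      linarith
  -- Here `P - Q 0` has nonnegative first coordinate, and a change of side in column 0 would touch
  -- the origin; so every change of side is a crossing, and the sum telescopes.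
  have left : ∀ j ≤ m, N 0 j =
      (if 0 ≤ (P j - Q 0).2 then 1 else 0) - (if 0 ≤ (P 0 - Q 0).2 then 1 else 0) := by
    intro j
    induction j with
    | zero => intro _; simp [N]
    | succ j ih =>
      intro hj
      have e := ih (by omega)
      have h₁ := hPx j (by omega)
      have h₃ := hne' j (by omega) 0 (by omega)
      have h₄ := hne' (j + 1) hj 0 (by omega)
      have h₅ := manh_le_one_cases (hP j (by omega))
      simp only [N, Finset.sum_range_succ] at e ⊢
      rw [e]
      simp only [rayCrossing, Prod.fst_sub, Prod.snd_sub]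
      split_ifs <;> omega
  have right : ∀ j ≤ m, N n j = 0 := by
    intro j hj
    refine Finset.sum_eq_zero fun s hs => ?_
    have h₁ := hPx s (by have := Finset.mem_range.1 hs; omega)
    simp only [rayCrossing, Prod.fst_sub, Prod.snd_sub]
    split_ifs <;> omega
  have e := const n le_rfl
  rw [right m le_rfl, left m le_rfl] at e
  have h₁ := hQy 0 (by omega)
  have h₂ := hPx 0 (by omega)
  have h₃ := hne' 0 (by omega) 0 (by omega)
  simp only [K, Prod.fst_sub, Prod.snd_sub] at e
  split_ifs at e <;> omega

/-- The part of a walk between two timesteps, in either order. -/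
theorem exists_walk_between {P : ℕ → Cell} (hP : ∀ t, manh (P t) (P (t + 1)) ≤ 1) (s₀ s₁ : ℕ) :
    ∃ (W : ℕ → Cell) (m : ℕ), W 0 = P s₀ ∧ W m = P s₁ ∧
      (∀ s < m, manh (W s) (W (s + 1)) ≤ 1) ∧ ∀ s ≤ m, ∃ r ∈ Set.uIcc s₀ s₁, W s = P r := by
  rcases le_total s₀ s₁ with h | h
  · refine ⟨fun s => P (s₀ + s), s₁ - s₀, rfl, by simp [h], fun s _ => hP _, fun s hs => ?_⟩
    exact ⟨s₀ + s, by rw [Set.uIcc_of_le h]; constructor <;> omega, rfl⟩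
  · refine ⟨fun s => P (s₀ - s), s₀ - s₁, rfl, by simp only [Nat.sub_sub_self h], fun s hs => ?_, fun s hs => ?_⟩
    · have := hP (s₀ - (s + 1))
      rw [show s₀ - (s + 1) + 1 = s₀ - s by omega] at this
      simpa only [manh, abs_sub_comm] using this
    · exact ⟨s₀ - s, by rw [Set.uIcc_of_ge h]; constructor <;> omega, rfl⟩

/-- The time intervals are unordered because nothing forces a path to visit its entrance before its
exit; a walk read backwards is still a walk. -/
theorem exists_common_cell {P Q : ℕ → Cell} {s₀ s₁ t₀ t₁ : ℕ} {x₀ x₁ y₀ y₁ : ℤ}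
    (hP : ∀ t, manh (P t) (P (t + 1)) ≤ 1) (hQ : ∀ t, manh (Q t) (Q (t + 1)) ≤ 1)
    (hPx : ∀ s ∈ Set.uIcc s₀ s₁, x₀ ≤ (P s).1 ∧ (P s).1 ≤ x₁)
    (hQy : ∀ t ∈ Set.uIcc t₀ t₁, y₀ ≤ (Q t).2 ∧ (Q t).2 ≤ y₁)
    (hP₀ : (P s₀).2 ≤ y₀) (hP₁ : y₁ ≤ (P s₁).2) (hQ₀ : (Q t₀).1 ≤ x₀) (hQ₁ : x₁ ≤ (Q t₁).1) :
    ∃ s ∈ Set.uIcc s₀ s₁, ∃ t ∈ Set.uIcc t₀ t₁, P s = Q t := by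
  obtain ⟨V, m, hV₀, hV₁, hV, hVP⟩ := exists_walk_between hP s₀ s₁
  obtain ⟨W, n, hW₀, hW₁, hW, hWQ⟩ := exists_walk_between hQ t₀ t₁
  obtain ⟨s, hs, t, ht, e⟩ := exists_common_cell_of_crossing (x₀ := x₀) (x₁ := x₁) (y₀ := y₀)
    (y₁ := y₁) hV hW
    (fun s hs => by obtain ⟨r, hr, e⟩ := hVP s hs; rw [e]; exact hPx r hr)
    (fun s hs => by obtain ⟨r, hr, e⟩ := hWQ s hs; rw [e]; exact hQy r hr)
    (by rwa [hV₀]) (by rwa [hV₁]) (by rwa [hW₀]) (by rwa [hW₁])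
  obtain ⟨r, hr, e₁⟩ := hVP s hs
  obtain ⟨r', hr', e₂⟩ := hWQ t ht
  exact ⟨r, hr, r', hr', by rw [← e₁, e, e₂]⟩

/-! ### Step temporal barriers in the coordinates of a rectangle -/

/-- A walk cannot beat the clock in any of the four diagonal directions. -/
theorem monotone_clock {P : ℕ → Cell} (hP : ∀ t, manh (P t) (P (t + 1)) ≤ 1) {α β : ℤ}
    (hα : α = 1 ∨ α = -1) (hβ : β = 1 ∨ β = -1) :
    Monotone fun t : ℕ => (t : ℤ) + α * (P t).1 + β * (P t).2 := by
  refine monotone_nat_of_le_succ fun t => ?_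
  have := manh_le_one_cases (hP t)
  push_cast
  rcases hα with rfl | rfl <;> rcases hβ with rfl | rfl <;> omega

theorem mem_Icc_of_mem_uIcc {f : ℕ → ℤ} (hf : Monotone f) {s₀ s₁ s : ℕ} {lo hi : ℤ}
    (hs : s ∈ Set.uIcc s₀ s₁) (h₀ : f s₀ ∈ Set.Icc lo hi) (h₁ : f s₁ ∈ Set.Icc lo hi) :
    f s ∈ Set.Icc lo hi := by
  rcases le_total s₀ s₁ with h | h
  · rw [Set.uIcc_of_le h] at hs
    exact ⟨h₀.1.trans (hf hs.1), (hf hs.2).trans h₁.2⟩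
  · rw [Set.uIcc_of_ge h] at hs
    exact ⟨h₁.1.trans (hf hs.1), (hf hs.2).trans h₀.2⟩

/-- Explains the shape of the step barrier. A vertex `d` before the segment is reached `2 * d` late
on the clock `t - s * x`, and one `d` beyond it is `2 * d` late on the clock `t + s * x`, compared
with the end of the segment. Shortening the blocked interval by `2 * d` keeps both clocks within the
bounds valid on the segment itself. -/
theorem stepBarrier_hLine_bounds {x : Cell × ℤ} {a b y r τ s : ℤ} {w : ℕ} (hs : s = 1 ∨ s = -1)
    (hab : 0 ≤ s * (b - a)) (hx : x ∈ stepBarrier (hLine y) (hSide a b y) ((a, r), τ) w) :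
    x.1.2 = y ∧
      x.2 - τ - |y - r| - s * (x.1.1 - a) ∈ Set.Icc 0 (w : ℤ) ∧
      x.2 - τ - |y - r| + s * (x.1.1 - a) ∈ Set.Icc 0 (w + 2 * (s * (b - a)) : ℤ) := by
  obtain ⟨⟨c, z⟩, t⟩ := x
  simp only [stepBarrier, temporalBarrier, range, hSide, hLine, ot, IsDist, manh, Set.mem_union,
    Set.mem_iUnion, Set.mem_ofPred_eq, exists_prop, Set.mem_Icc, Set.mem_uIcc] at hx ⊢
  rcases hx with ⟨v, ⟨hv₁, hv₂⟩, rfl, h₁, h₂⟩ | ⟨rfl, d, h₁, h₂, ⟨⟨u, ⟨hu₁, hu₂⟩, hu⟩, -⟩, -, h₃, h₄⟩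
  · simp only at *
    subst hv₂
    rcases abs_cases (c - a) with h | h <;> rcases hs with rfl | rfl <;> omega
  · refine ⟨rfl, ?_⟩
    simp only [hu₂, sub_self, abs_zero, add_zero] at *
    rcases abs_cases (c - a) with h | h <;> rcases abs_cases (c - u.1) with h' | h' <;>
      rcases hs with rfl | rfl <;> omega

theorem stepBarrier_vLine_bounds {x : Cell × ℤ} {a b y r τ s : ℤ} {w : ℕ} (hs : s = 1 ∨ s = -1)
    (hab : 0 ≤ s * (b - a)) (hx : x ∈ stepBarrier (vLine y) (vSide y a b) ((r, a), τ) w) :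
    x.1.1 = y ∧
      x.2 - τ - |y - r| - s * (x.1.2 - a) ∈ Set.Icc 0 (w : ℤ) ∧
      x.2 - τ - |y - r| + s * (x.1.2 - a) ∈ Set.Icc 0 (w + 2 * (s * (b - a)) : ℤ) := by
  obtain ⟨⟨z, c⟩, t⟩ := x
  simp only [stepBarrier, temporalBarrier, range, vSide, vLine, ot, IsDist, manh, Set.mem_union,
    Set.mem_iUnion, Set.mem_ofPred_eq, exists_prop, Set.mem_Icc, Set.mem_uIcc] at hx ⊢
  rcases hx with ⟨v, ⟨hv₁, hv₂⟩, rfl, h₁, h₂⟩ | ⟨rfl, d, h₁, h₂, ⟨⟨u, ⟨hu₁, hu₂⟩, hu⟩, -⟩, -, h₃, h₄⟩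
  · simp only at *
    subst hv₁
    rcases abs_cases (c - a) with h | h <;> rcases hs with rfl | rfl <;> omega
  · refine ⟨rfl, ?_⟩
    simp only [hu₁, sub_self, abs_zero, zero_add] at *
    rcases abs_cases (c - a) with h | h <;> rcases abs_cases (c - u.2) with h' | h' <;>
      rcases hs with rfl | rfl <;> omega

namespace RootedRect

/-- The coordinates of a cell with respect to the root corner and the orientation. -/
def coord (R : RootedRect) (v : Cell) : Cell := (R.sx * (v.1 - R.D.1), R.sy * (v.2 - R.D.2))

theorem coord_injective (R : RootedRect) : Function.Injective R.coord := by
  intro u v h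
  simp only [coord, Prod.mk.injEq] at h
  obtain ⟨h₁, h₂⟩ := h
  ext
  · rcases R.hsx with e | e <;> rw [e] at h₁ <;> omega
  · rcases R.hsy with e | e <;> rw [e] at h₂ <;> omega

theorem manh_coord (R : RootedRect) (u v : Cell) : manh (R.coord u) (R.coord v) = manh u v := by
  simp only [manh, coord, ← mul_sub, abs_mul, sub_sub_sub_cancel_right]
  rcases R.hsx with e | e <;> rcases R.hsy with e' | e' <;> simp [e, e']

/-- The delay with respect to the root time of a vertex-time pair. -/
def delay (R : RootedRect) (rt : ℤ) (x : Cell × ℤ) : ℤ := x.2 - rt - (R.coord x.1).1 - (R.coord x.1).2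

variable {R : RootedRect} {rt : ℤ} {k₁ k₂ : ℕ} {x : Cell × ℤ}

/-- The shift of the root vertex by `l₁` and of its time by `-l₁` cancel in the delay, so the window
is independent of the shift, and it is the same for the exit. -/
theorem entrance₁_bounds (hx : x ∈ R.entrance₁ rt k₁ k₂) :
    (R.coord x.1).2 = -(k₁ / 2 : ℕ) ∧ R.delay rt x ∈ Set.Icc 0 (k₂ : ℤ) ∧
      R.delay rt x + 2 * (R.coord x.1).1 ∈ Set.Icc 0 (k₂ + 2 * (R.sx * (R.E.1 - R.D.1))) := by
  obtain ⟨h₁, h₂, h₃⟩ := stepBarrier_hLine_bounds R.hsx R.hx hx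
  have e : (R.coord x.1).2 = -(k₁ / 2 : ℕ) := by
    simp only [coord, h₁, row₁]
    rcases R.hsy with e | e <;> rw [e] <;> omega
  simp only [sub_self, abs_zero] at h₂ h₃
  refine ⟨e, ?_, ?_⟩ <;> simp only [delay, e] <;> simp only [coord, Set.mem_Icc] at * <;> omega

theorem exit₁_bounds (hx : x ∈ R.exit₁ rt k₁ k₂) :
    (R.coord x.1).2 = R.sy * (R.E.2 - R.D.2) + (k₁ / 2 : ℕ) ∧ R.delay rt x ∈ Set.Icc 0 (k₂ : ℤ) ∧
      R.delay rt x + 2 * (R.coord x.1).1 ∈ Set.Icc 0 (k₂ + 2 * (R.sx * (R.E.1 - R.D.1))) := by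
  obtain ⟨h₁, h₂, h₃⟩ := stepBarrier_hLine_bounds R.hsx R.hx hx
  have e : (R.coord x.1).2 = R.sy * (R.E.2 - R.D.2) + (k₁ / 2 : ℕ) := by
    simp only [coord, h₁, row₄]
    rcases R.hsy with e | e <;> rw [e] <;> omega
  have e' : |R.row₄ (k₁ / 2 : ℕ) - R.row₁ (k₁ / 2 : ℕ)| =
      R.sy * (R.E.2 - R.D.2) + 2 * (k₁ / 2 : ℕ) := by
    have := R.hy
    simp only [row₁, row₄]
    rcases R.hsy with e | e <;> rw [e] at this ⊢
    · rw [abs_of_nonneg] <;> omega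
    · rw [abs_of_nonpos] <;> omega
  rw [e'] at h₂ h₃
  refine ⟨e, ?_, ?_⟩ <;> simp only [delay, e] <;> simp only [coord, Set.mem_Icc] at * <;> omega

theorem entrance₂_bounds (hx : x ∈ R.entrance₂ rt k₁ k₂) :
    (R.coord x.1).1 = -(k₂ / 2 : ℕ) ∧ R.delay rt x ∈ Set.Icc 0 (k₁ : ℤ) ∧
      R.delay rt x + 2 * (R.coord x.1).2 ∈ Set.Icc 0 (k₁ + 2 * (R.sy * (R.E.2 - R.D.2))) := by
  obtain ⟨h₁, h₂, h₃⟩ := stepBarrier_vLine_bounds R.hsy R.hy hx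
  have e : (R.coord x.1).1 = -(k₂ / 2 : ℕ) := by
    simp only [coord, h₁, col₂]
    rcases R.hsx with e | e <;> rw [e] <;> omega
  simp only [sub_self, abs_zero] at h₂ h₃
  refine ⟨e, ?_, ?_⟩ <;> simp only [delay, e] <;> simp only [coord, Set.mem_Icc] at * <;> omega

theorem exit₂_bounds (hx : x ∈ R.exit₂ rt k₁ k₂) :
    (R.coord x.1).1 = R.sx * (R.E.1 - R.D.1) + (k₂ / 2 : ℕ) ∧ R.delay rt x ∈ Set.Icc 0 (k₁ : ℤ) ∧
      R.delay rt x + 2 * (R.coord x.1).2 ∈ Set.Icc 0 (k₁ + 2 * (R.sy * (R.E.2 - R.D.2))) := by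
  obtain ⟨h₁, h₂, h₃⟩ := stepBarrier_vLine_bounds R.hsy R.hy hx
  have e : (R.coord x.1).1 = R.sx * (R.E.1 - R.D.1) + (k₂ / 2 : ℕ) := by
    simp only [coord, h₁, col₃]
    rcases R.hsx with e | e <;> rw [e] <;> omega
  have e' : |R.col₃ (k₂ / 2 : ℕ) - R.col₂ (k₂ / 2 : ℕ)| =
      R.sx * (R.E.1 - R.D.1) + 2 * (k₂ / 2 : ℕ) := by
    have := R.hx
    simp only [col₂, col₃]
    rcases R.hsx with e | e <;> rw [e] at this ⊢
    · rw [abs_of_nonneg] <;> omega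
    · rw [abs_of_nonpos] <;> omega
  rw [e'] at h₂ h₃
  refine ⟨e, ?_, ?_⟩ <;> simp only [delay, e] <;> simp only [coord, Set.mem_Icc] at * <;> omega

/-- Two walks that both traverse their entrances and exits visit a common cell, with a delay of at
most `max k₁ k₂`. -/
theorem exists_common_visit {p q : ℕ → Cell} (hp : ∀ t, manh (p t) (p (t + 1)) ≤ 1)
    (hq : ∀ t, manh (q t) (q (t + 1)) ≤ 1)
    (hp₀ : Traverses p (R.entrance₁ rt k₁ k₂)) (hp₁ : Traverses p (R.exit₁ rt k₁ k₂))
    (hq₀ : Traverses q (R.entrance₂ rt k₁ k₂)) (hq₁ : Traverses q (R.exit₂ rt k₁ k₂)) :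
    ∃ s t : ℕ, p s = q t ∧ (s : ℤ) ≤ t + k₂ ∧ (t : ℤ) ≤ s + k₁ := by
  obtain ⟨s₀, hs₀⟩ := hp₀
  obtain ⟨s₁, hs₁⟩ := hp₁
  obtain ⟨t₀, ht₀⟩ := hq₀
  obtain ⟨t₁, ht₁⟩ := hq₁
  obtain ⟨a₀, b₀, c₀⟩ := entrance₁_bounds hs₀
  obtain ⟨a₁, b₁, c₁⟩ := exit₁_bounds hs₁
  obtain ⟨a₂, b₂, c₂⟩ := entrance₂_bounds ht₀
  obtain ⟨a₃, b₃, c₃⟩ := exit₂_bounds ht₁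
  have hp' : ∀ t, manh (R.coord (p t)) (R.coord (p (t + 1))) ≤ 1 := fun t => by
    rw [manh_coord]; exact hp t
  have hq' : ∀ t, manh (R.coord (q t)) (R.coord (q (t + 1))) ≤ 1 := fun t => by
    rw [manh_coord]; exact hq t
  have hP : ∀ s ∈ Set.uIcc s₀ s₁, R.delay rt (p s, s) ∈ Set.Icc 0 (k₂ : ℤ) ∧
      R.delay rt (p s, s) + 2 * (R.coord (p s)).1 ∈
        Set.Icc 0 (k₂ + 2 * (R.sx * (R.E.1 - R.D.1))) := by
    intro s hs
    constructor
    · refine mem_Icc_of_mem_uIcc (f := fun s => R.delay rt (p s, s)) (fun s t hst => ?_) hs b₀ b₁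
      have := monotone_clock hp' (α := -1) (β := -1) (by simp) (by simp) hst
      simp only [delay] at this ⊢
      linarith
    · refine mem_Icc_of_mem_uIcc (f := fun s => R.delay rt (p s, s) + 2 * (R.coord (p s)).1)
        (fun s t hst => ?_) hs c₀ c₁
      have := monotone_clock hp' (α := 1) (β := -1) (by simp) (by simp) hst
      simp only [delay] at this ⊢
      linarith
  have hQ : ∀ t ∈ Set.uIcc t₀ t₁, R.delay rt (q t, t) ∈ Set.Icc 0 (k₁ : ℤ) ∧
      R.delay rt (q t, t) + 2 * (R.coord (q t)).2 ∈
        Set.Icc 0 (k₁ + 2 * (R.sy * (R.E.2 - R.D.2))) := by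
    intro s hs
    constructor
    · refine mem_Icc_of_mem_uIcc (f := fun s => R.delay rt (q s, s)) (fun s t hst => ?_) hs b₂ b₃
      have := monotone_clock hq' (α := -1) (β := -1) (by simp) (by simp) hst
      simp only [delay] at this ⊢
      linarith
    · refine mem_Icc_of_mem_uIcc (f := fun s => R.delay rt (q s, s) + 2 * (R.coord (q s)).2)
        (fun s t hst => ?_) hs c₂ c₃
      have := monotone_clock hq' (α := -1) (β := 1) (by simp) (by simp) hst
      simp only [delay] at this ⊢
      linarith
  -- Subtracting the two clock bounds gives `-k₂ ≤ 2x ≤ k₂ + 2 * width`; by integrality the excess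
  -- on either side is at most `⌊k₂/2⌋`, the shift of the columns. Likewise for the rows with `k₁`.
  obtain ⟨s, hs, t, ht, e⟩ := exists_common_cell hp' hq'
    (fun s hs => by
      obtain ⟨⟨h₁, h₂⟩, h₃, h₄⟩ := hP s hs
      exact ⟨show -((k₂ / 2 : ℕ) : ℤ) ≤ _ by omega,
        show _ ≤ R.sx * (R.E.1 - R.D.1) + ((k₂ / 2 : ℕ) : ℤ) by omega⟩)
    (fun s hs => by
      obtain ⟨⟨h₁, h₂⟩, h₃, h₄⟩ := hQ s hs
      exact ⟨show -((k₁ / 2 : ℕ) : ℤ) ≤ _ by omega,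
        show _ ≤ R.sy * (R.E.2 - R.D.2) + ((k₁ / 2 : ℕ) : ℤ) by omega⟩)
    a₀.le a₁.ge a₂.le a₃.ge
  have e' := R.coord_injective e
  have h₁ := (hP s hs).1
  have h₂ := (hQ t ht).1
  simp only [delay, Set.mem_Icc] at h₁ h₂
  rw [e'] at h₁
  exact ⟨s, t, e', by linarith, by linarith⟩

end RootedRect

variable {ι : Type*}

/-! ### Paths and constraints -/

theorem IsPath.manh_le_one {I : Instance ι} {i : ι} {p : ℕ → Cell} (hp : IsPath I i p) (t : ℕ) :
    manh (p t) (p (t + 1)) ≤ 1 := by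
  rcases hp.step t with h | h
  · simp [h, manh]
  · exact h.le

theorem IsPath.eq_goal_of_cost_le {I : Instance ι} {i : ι} {p : ℕ → Cell} (hp : IsPath I i p)
    {t : ℕ} (ht : cost I i p ≤ t) : p t = I.goal i :=
  Nat.sInf_mem (s := {T | ∀ t, T ≤ t → p t = I.goal i}) hp.rest t ht

theorem cost_le {I : Instance ι} {i : ι} {p : ℕ → Cell} {T : ℕ}
    (h : ∀ t, T ≤ t → p t = I.goal i) : cost I i p ≤ T :=
  Nat.sInf_le (s := {T | ∀ t, T ≤ t → p t = I.goal i}) h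

/-- Such a path is determined by its first `B` positions, all in the finite map. -/
theorem finite_setOf_cost_le (I : Instance ι) (i : ι) (B : ℕ) :
    {p | IsPath I i p ∧ cost I i p ≤ B}.Finite := by
  let f : (ℕ → Cell) → (Fin B → Cell) := fun p t => p t
  refine Set.Finite.of_finite_image (f := f) ?_ ?_
  · refine (Set.Finite.pi' (t := fun _ : Fin B => (I.cells : Set Cell))
      fun _ => I.cells.finite_toSet).subset ?_
    rintro _ ⟨p, hp, rfl⟩ t
    exact hp.1.mem t
  · intro p hp q hq h
    funext t
    by_cases ht : t < B
    · exact congrFun h ⟨t, ht⟩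
    · rw [hp.1.eq_goal_of_cost_le (hp.2.trans (by omega)),
        hq.1.eq_goal_of_cost_le (hq.2.trans (by omega))]

theorem Violates.mono {C C' : Set (Constraint ι)} (h : C ⊆ C') {i : ι} {p : ℕ → Cell}
    (hv : Violates C i p) : Violates C' i p :=
  hv.imp (fun ⟨t, ht⟩ => ⟨t, h ht⟩) (fun ⟨t, ht⟩ => ⟨t, h ht⟩)

theorem violates_union {C C' : Set (Constraint ι)} {i : ι} {p : ℕ → Cell} :
    Violates (C ∪ C') i p ↔ Violates C i p ∨ Violates C' i p := by
  simp only [Violates, Set.mem_union, exists_or]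
  tauto

theorem violates_forbid {a i : ι} {B : Barrier} {p : ℕ → Cell} :
    Violates (forbid a B) i p ↔ i = a ∧ Traverses p B := by
  constructor
  · rintro (⟨t, x, hx, h⟩ | ⟨t, x, hx, h⟩)
    · simp only [Constraint.at_.injEq] at h
      obtain ⟨rfl, h₁, h₂⟩ := h
      exact ⟨rfl, t, by rw [h₁, h₂]; exact hx⟩
    · cases h
  · rintro ⟨rfl, t, ht⟩
    exact Or.inl ⟨t, _, ht, rfl⟩

theorem violates_move {a i : ι} {u v : Cell} {t : ℕ} {p : ℕ → Cell} :
    Violates {Constraint.move a u v t} i p ↔ i = a ∧ p t = u ∧ p (t + 1) = v := by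
  constructor
  · rintro (⟨s, h⟩ | ⟨s, h⟩)
    · cases h
    · simp only [Set.mem_singleton_iff, Constraint.move.injEq] at h
      obtain ⟨rfl, h₁, h₂, rfl⟩ := h
      exact ⟨rfl, h₁, h₂⟩
  · rintro ⟨rfl, rfl, rfl⟩
    exact Or.inr ⟨t, rfl⟩

theorem exists_isOptPath {I : Instance ι} {C : Set (Constraint ι)} {i : ι} {p : ℕ → Cell}
    (hp : Consistent I C i p) : ∃ q, IsOptPath I C i q := by
  obtain ⟨q, hq, hmin⟩ := WellFounded.has_min (measure (cost I i)).wf {q | Consistent I C i q} ⟨p, hp⟩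
  exact ⟨q, hq, fun r hr => not_lt.1 (hmin r hr)⟩

/-! ### Splicing paths and Condition 1 -/

/-- Follow `p` up to timestep `t`, and `q` afterwards. -/
def splice (p q : ℕ → Cell) (t : ℕ) : ℕ → Cell := fun s => if s ≤ t then p s else q s

theorem splice_of_le {p q : ℕ → Cell} {t s : ℕ} (h : s ≤ t) : splice p q t s = p s := if_pos h

theorem splice_of_ge {p q : ℕ → Cell} {t s : ℕ} (e : p t = q t) (h : t ≤ s) :
    splice p q t s = q s := by
  rcases h.eq_or_lt with rfl | h
  · rw [splice_of_le le_rfl, e]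
  · exact if_neg (by omega)

theorem Consistent.splice {I : Instance ι} {C : Set (Constraint ι)} {i : ι} {p q : ℕ → Cell} {t : ℕ}
    (hp : Consistent I C i p) (hq : Consistent I C i q) (e : p t = q t) :
    Consistent I C i (splice p q t) := by
  refine ⟨⟨?_, fun s => ?_, fun s => ?_, ?_⟩, ?_⟩
  · rw [splice_of_le (Nat.zero_le t), hp.1.start]
  · unfold KRobust.splice
    split_ifs
    exacts [hp.1.mem s, hq.1.mem s]
  · rcases Nat.lt_or_ge s t with h | h
    · rw [splice_of_le h.le, splice_of_le (show s + 1 ≤ t from h)]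
      exact hp.1.step s
    · rw [splice_of_ge e h, splice_of_ge e (show t ≤ s + 1 by omega)]
      exact hq.1.step s
  · obtain ⟨T, hT⟩ := hq.1.rest
    refine ⟨max t T, fun s hs => ?_⟩
    rw [splice_of_ge e ((le_max_left _ _).trans hs), hT s ((le_max_right _ _).trans hs)]
  · rintro (⟨s, h⟩ | ⟨s, h⟩)
    · rcases le_total s t with hs | hs
      · rw [splice_of_le hs] at h
        exact hp.2 (Or.inl ⟨s, h⟩)
      · rw [splice_of_ge e hs] at h
        exact hq.2 (Or.inl ⟨s, h⟩)
    · rcases Nat.lt_or_ge s t with hs | hs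
      · rw [splice_of_le hs.le, splice_of_le (show s + 1 ≤ t from hs)] at h
        exact hp.2 (Or.inr ⟨s, h⟩)
      · rw [splice_of_ge e hs, splice_of_ge e (show t ≤ s + 1 by omega)] at h
        exact hq.2 (Or.inr ⟨s, h⟩)

/-- The path `p` may be arbitrarily expensive: beyond `t` the spliced path rests at the goal as soon
as `q` does. -/
theorem MddPath.splice {I : Instance ι} {k : ℕ} {N : Node ι} {i : ι} {p q : ℕ → Cell} {t : ℕ}
    (hp : Consistent I N.cons i p) (hq : MddPath I k N i q) (e : p t = q t)
    (ht : t ≤ mddDepth I k N i) : MddPath I k N i (splice p q t) := by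
  refine ⟨hp.splice hq.1 e, (cost_le (T := max t (cost I i q)) fun s hs => ?_).trans
    (max_le ht hq.2)⟩
  rw [splice_of_ge e ((le_max_left _ _).trans hs),
    hq.1.1.eq_goal_of_cost_le ((le_max_right _ _).trans hs)]

theorem mddReach_of_mddPath {I : Instance ι} {k : ℕ} {N : Node ι} {i : ι} {block : Barrier}
    {p : ℕ → Cell} (hp : MddPath I k N i p) {t : ℕ} (ht : t ≤ mddDepth I k N i)
    (hb : ∀ s ≤ t, (p s, (s : ℤ)) ∉ block) : MddReach I k N i block (p t) t := by
  induction t with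
  | zero =>
    have h₀ := hb 0 le_rfl
    rw [hp.1.1.start] at h₀ ⊢
    exact .source ⟨Nat.zero_le _, p, hp, hp.1.1.start⟩ h₀
  | succ t ih =>
    exact .next (ih (by omega) fun s hs => hb s (by omega)) ⟨ht, p, hp, rfl, rfl⟩ (hb _ le_rfl)

theorem usedExit_subset {I : Instance ι} {k : ℕ} {N : Node ι} {i : ι} {ex : Barrier} {mode : Mode} :
    usedExit I k N i ex mode ⊆ ex := by
  cases mode
  exacts [subset_rfl, fun _ h => h.1]

/-- Under Condition 1, whatever traverses the exit barrier that is imposed traverses the entrance. -/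
theorem Condition1.traverses {I : Instance ι} {k : ℕ} {N : Node ι} {i : ι} {en ex : Barrier}
    {mode : Mode} (hc : Condition1 I k N i en ex mode) {p : ℕ → Cell}
    (hp : Consistent I N.cons i p) (ht : Traverses p (usedExit I k N i ex mode)) :
    Traverses p en := by
  cases mode with
  | full => exact hc p hp ht
  | mdd =>
    obtain ⟨t, hex, t', e, ht', q, hq, hqt⟩ := ht
    obtain rfl : t = t' := Int.ofNat_inj.1 e
    by_contra hen
    -- `p` itself need not be stored in the `k`-MDD, but `p` up to `t` continued by `q` is; its part
    -- up to `t` is that of `p`, which misses the entrance, so the exit pair stays reachable.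
    have hr := mddReach_of_mddPath (block := en) (MddPath.splice hp hq hqt.symm ht') ht'
      fun s hs h => hen ⟨s, by rwa [splice_of_le hs] at h⟩
    rw [splice_of_le le_rfl] at hr
    exact hc _ _ hex hr

/-! ### Branching -/

theorem IsSolution.lt_delay {I : Instance ι} {k : ℕ} {π : ι → ℕ → Cell} (hπ : IsSolution I k π)
    {i j : ι} (hij : i ≠ j) {s t : ℕ} (h : π i s = π j t) : s + k < t ∨ t + k < s := by
  by_contra! hlt
  refine hπ.2 (Or.inl ?_)
  rcases le_total s t with hs | hs
  · exact ⟨i, j, π j t, s, t - s, hij, by omega, h, by rw [Nat.add_sub_cancel' hs]⟩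
  · exact ⟨j, i, π j t, t, s - t, hij.symm, by omega, rfl, by rw [Nat.add_sub_cancel' hs, h]⟩

/-- A solution excluded by both branches would have the two agents visit a common vertex at most `k`
timesteps apart, or swap. -/
theorem permits_branch {I : Instance ι} {k : ℕ} {N : Node ι} {r : Resolution ι}
    (hr : Valid I k N r) {π : ι → ℕ → Cell} (hπ : IsSolution I k π) (hN : Permits N.cons π) :
    Permits (N.cons ∪ (branches I k N r).1.2) π ∨ Permits (N.cons ∪ (branches I k N r).2.2) π := by
  by_contra! h
  simp only [Permits, violates_union, not_forall, not_not] at h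
  obtain ⟨⟨i', h₁⟩, j', h₂⟩ := h
  replace h₁ := h₁.resolve_left (hN i')
  replace h₂ := h₂.resolve_left (hN j')
  cases r with
  | vertex i j v t Δ =>
    simp only [branches, violates_forbid] at h₁ h₂
    obtain ⟨rfl, s, e₁, h₁, h₁'⟩ := h₁
    obtain ⟨rfl, s', e₂, h₂, h₂'⟩ := h₂
    simp only at e₁ h₁ h₁' e₂ h₂ h₂'
    rcases hπ.lt_delay hr.1 (e₁.trans e₂.symm) with h | h <;> omega
  | swap i j u v t =>
    simp only [branches, violates_move] at h₁ h₂
    obtain ⟨rfl, h₁, h₁'⟩ := h₁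
    obtain ⟨rfl, h₂, h₂'⟩ := h₂
    exact hπ.2 (Or.inr ⟨i', j', u, v, t, hr.1, hr.2.1, h₁, h₁', h₂, h₂'⟩)
  | rect mode a b R rt k₁ k₂ =>
    simp only [branches, violates_forbid] at h₁ h₂
    obtain ⟨rfl, h₁⟩ := h₁
    obtain ⟨rfl, h₂⟩ := h₂
    obtain ⟨hab, hk₁, hk₂, c₁, c₂, -, -⟩ := hr
    have d₁ := c₁.traverses ⟨hπ.1 _, hN _⟩ h₁
    have d₂ := c₂.traverses ⟨hπ.1 _, hN _⟩ h₂
    obtain ⟨s, hs⟩ := h₁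
    obtain ⟨s', hs'⟩ := h₂
    obtain ⟨t, t', e, h, h'⟩ := RootedRect.exists_common_visit (hπ.1 _).manh_le_one
      (hπ.1 _).manh_le_one d₁ ⟨s, usedExit_subset hs⟩ d₂ ⟨s', usedExit_subset hs'⟩
    rcases hπ.lt_delay hab e with h | h <;> omega

theorem violates_branches {I : Instance ι} {k : ℕ} {N : Node ι} {r : Resolution ι}
    (hr : Valid I k N r) :
    Violates (branches I k N r).1.2 (branches I k N r).1.1 (N.paths (branches I k N r).1.1) ∧
      Violates (branches I k N r).2.2 (branches I k N r).2.1 (N.paths (branches I k N r).2.1) := by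
  cases r with
  | vertex i j v t Δ =>
    obtain ⟨-, h, h₁, h₂⟩ := hr
    simp only [branches, violates_forbid, true_and]
    exact ⟨⟨t, h₁, le_rfl, by simp⟩, t + Δ, h₂, by simp, by simpa using h⟩
  | swap i j u v t =>
    obtain ⟨-, -, h₁, h₂, h₃, h₄⟩ := hr
    simp only [branches, violates_move, true_and]
    exact ⟨⟨h₁, h₂⟩, h₃, h₄⟩
  | rect mode a b R rt k₁ k₂ =>
    simp only [branches, violates_forbid, true_and]
    exact hr.2.2.2.2.2

theorem eq_of_violates_branches {I : Instance ι} {k : ℕ} {N : Node ι} {r : Resolution ι}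
    {i : ι} {p : ℕ → Cell} :
    (Violates (branches I k N r).1.2 i p → i = (branches I k N r).1.1) ∧
      (Violates (branches I k N r).2.2 i p → i = (branches I k N r).2.1) := by
  cases r <;> simp only [branches, violates_forbid, violates_move] <;>
    exact ⟨fun h => h.1, fun h => h.1⟩

/-! ### Children -/

section Children

variable {I : Instance ι} {N : Node ι} {a : ι} {C : Set (Constraint ι)} {S : Multiset (Node ι)}

theorem exists_child (I : Instance ι) (N : Node ι) (a : ι) (C : Set (Constraint ι)) :
    ∃ S, Child I N a C S := by
  classical
  by_cases h : ∃ p, Consistent I (N.cons ∪ C) a p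
  · obtain ⟨p, hp⟩ := h
    obtain ⟨q, hq⟩ := exists_isOptPath hp
    exact ⟨_, Or.inl ⟨⟨N.cons ∪ C, Function.update N.paths a q⟩, rfl, rfl,
      fun i hi => Function.update_of_ne hi _ _, by simpa using hq⟩⟩
  · push Not at h
    exact ⟨0, Or.inr ⟨rfl, h⟩⟩

/-- The agents that are not replanned keep optimal paths because the new constraints concern `a`
alone. -/
theorem Child.wf (h : Child I N a C S) (hN : N.Wf I) (hC : ∀ i p, Violates C i p → i = a) :
    ∀ M ∈ S, M.Wf I := by
  rcases h with ⟨N', rfl, hc, hp, ho⟩ | ⟨rfl, -⟩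
  · intro M hM i
    obtain rfl := Multiset.mem_singleton.1 hM
    rw [hc]
    by_cases hi : i = a
    · rwa [hi]
    · rw [hp i hi]
      refine ⟨⟨(hN i).1.1, fun hv => ?_⟩, fun q hq => ?_⟩
      · rcases violates_union.1 hv with hv | hv
        exacts [(hN i).1.2 hv, hi (hC _ _ hv)]
      · exact (hN i).2 q ⟨hq.1, fun hv => hq.2 (violates_union.2 (Or.inl hv))⟩
  · simp

theorem Child.exists_permits {k : ℕ} (h : Child I N a C S) {π : ι → ℕ → Cell}
    (hπ : IsSolution I k π) (hC : Permits (N.cons ∪ C) π) : ∃ M ∈ S, Permits M.cons π := by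
  rcases h with ⟨N', rfl, hc, -, -⟩ | ⟨-, h⟩
  · exact ⟨N', by simp, by rwa [hc]⟩
  · exact absurd ⟨hπ.1 a, hC a⟩ (h _)

end Children

/-! ### The search -/

/-- The invariant of the search: the nodes in OPEN are well-formed, and every solution is permitted
by one of them. -/
def Covering (I : Instance ι) (k : ℕ) (S : Multiset (Node ι)) : Prop :=
  (∀ N ∈ S, N.Wf I) ∧ ∀ π, IsSolution I k π → ∃ N ∈ S, Permits N.cons π

theorem exists_init (I : Instance ι) : ∃ S, Init I S := by
  by_cases hI : ∃ i, ∀ p, ¬ IsPath I i p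
  · exact ⟨0, Or.inr ⟨rfl, hI⟩⟩
  · push Not at hI
    have : ∀ i, ∃ q, IsOptPath I ∅ i q := fun i => by
      obtain ⟨p, hp⟩ := hI i
      exact exists_isOptPath (p := p) ⟨hp, by simp [Violates]⟩
    choose q hq using this
    exact ⟨_, Or.inl ⟨⟨∅, q⟩, rfl, rfl, hq⟩⟩

theorem Init.covering {I : Instance ι} {k : ℕ} {S : Multiset (Node ι)} (hS : Init I S) : Covering I k S := by
  rcases hS with ⟨N, rfl, hc, hN⟩ | ⟨rfl, i, hi⟩
  · exact ⟨by simpa using hN, fun π _ => ⟨N, by simp, fun i => by simp [hc, Violates]⟩⟩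
  · exact ⟨by simp, fun π hπ => absurd (hπ.1 i) (hi _)⟩

section Search

variable [Fintype ι] {I : Instance ι} {k : ℕ} {h : Node ι → ℕ} {rule : Node ι → Resolution ι → Prop}

/-- The number of paths of cost at most `B` that respect the constraints of a node. -/
noncomputable def freedom (I : Instance ι) (B : ℕ) (N : Node ι) : ℕ :=
  ∑ i, {p | Consistent I N.cons i p ∧ cost I i p ≤ B}.ncard

/-- A potential of the OPEN list that decreases when a node of cost at most `B` is expanded. -/
noncomputable def potential (I : Instance ι) (B : ℕ) (S : Multiset (Node ι)) : ℕ :=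
  (S.map fun N => 3 ^ freedom I B N).sum

/-- The current path of `a` costs at most `B`, so it is counted at `N`, but it is excluded at `N'`.
-/
theorem freedom_lt {B : ℕ} {N N' : Node ι} {a : ι} (hN : N.Wf I) (hB : sic I N.paths ≤ B)
    (hsub : N.cons ⊆ N'.cons) (hv : Violates N'.cons a (N.paths a)) :
    freedom I B N' < freedom I B N := by
  have fin : ∀ i, {p | Consistent I N.cons i p ∧ cost I i p ≤ B}.Finite := fun i =>
    (finite_setOf_cost_le I i B).subset fun p hp => ⟨hp.1.1, hp.2⟩
  have sub : ∀ i, {p | Consistent I N'.cons i p ∧ cost I i p ≤ B} ⊆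
      {p | Consistent I N.cons i p ∧ cost I i p ≤ B} := fun i p hp =>
    ⟨⟨hp.1.1, fun h => hp.1.2 (h.mono hsub)⟩, hp.2⟩
  refine Finset.sum_lt_sum (fun i _ => Set.ncard_le_ncard (sub i) (fin i))
    ⟨a, Finset.mem_univ a, Set.ncard_lt_ncard ⟨sub a, fun hs => ?_⟩ (fin a)⟩
  have hle : cost I a (N.paths a) ≤ sic I N.paths :=
    Finset.single_le_sum (f := fun i => cost I i (N.paths i)) (fun _ _ => Nat.zero_le _)
      (Finset.mem_univ a)
  exact (hs ⟨(hN a).1, hle.trans hB⟩).1.2 hv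

/-- Base 3 makes each branch at most a third of its parent, so that two branches together remain
strictly below it. -/
theorem Child.potential_le {B : ℕ} {N : Node ι} {a : ι} {C : Set (Constraint ι)}
    {S : Multiset (Node ι)} (hS : Child I N a C S) (hN : N.Wf I) (hB : sic I N.paths ≤ B)
    (hv : Violates C a (N.paths a)) : 3 * potential I B S ≤ 3 ^ freedom I B N := by
  rcases hS with ⟨N', rfl, hc, -, -⟩ | ⟨rfl, -⟩
  · have := freedom_lt (N' := N') hN hB (hc ▸ Set.subset_union_left)
      (hc ▸ hv.mono Set.subset_union_right)
    simp only [potential, Multiset.map_singleton, Multiset.sum_singleton]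
    rw [← pow_succ']
    exact Nat.pow_le_pow_right (by norm_num) this
  · simp [potential]

theorem Step.covering {S S' : Multiset (Node ι)} (hs : Step I k h rule S S')
    (hS : Covering I k S) : Covering I k S' := by
  obtain ⟨N, T, r, S₁, S₂, rfl, -, -, hr, -, h₁, h₂, rfl⟩ := hs
  have hN := hS.1 N (by simp)
  refine ⟨fun M hM => ?_, fun π hπ => ?_⟩
  · rw [Multiset.mem_add, Multiset.mem_add] at hM
    rcases hM with (hM | hM) | hM
    · exact h₁.wf hN (fun _ _ => eq_of_violates_branches.1) M hM
    · exact h₂.wf hN (fun _ _ => eq_of_violates_branches.2) M hM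
    · exact hS.1 M (Multiset.mem_cons_of_mem hM)
  · obtain ⟨M, hM, hp⟩ := hS.2 π hπ
    simp only [Multiset.mem_add]
    rcases Multiset.mem_cons.1 hM with rfl | hM
    · rcases permits_branch hr hπ hp with hp | hp
      · obtain ⟨M', hM', hp'⟩ := h₁.exists_permits hπ hp
        exact ⟨M', Or.inl (Or.inl hM'), hp'⟩
      · obtain ⟨M', hM', hp'⟩ := h₂.exists_permits hπ hp
        exact ⟨M', Or.inl (Or.inr hM'), hp'⟩
    · exact ⟨M, Or.inr hM, hp⟩

theorem covering_of_reflTransGen {S₀ S : Multiset (Node ι)} (h₀ : Covering I k S₀)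
    (hs : Relation.ReflTransGen (Step I k h rule) S₀ S) : Covering I k S := by
  induction hs with
  | refl => exact h₀
  | tail _ hs ih => exact hs.covering ih

/-- Some open node permits `π`, so its priority is at most the cost of `π`; the minimal node has no
greater priority, and its heuristic value is nonnegative. -/
theorem IsMin.sic_le (hadm : Admissible I k h) {S : Multiset (Node ι)} {N : Node ι}
    (hN : IsMin I h S N) (hS : Covering I k S) {π : ι → ℕ → Cell} (hπ : IsSolution I k π) :
    sic I N.paths ≤ sic I π := by
  obtain ⟨M, hM, hp⟩ := hS.2 π hπ
  exact (Nat.le_add_right _ _).trans ((hN.2 M hM).trans (hadm M (hS.1 M hM) π hπ hp))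

theorem exists_isMin (I : Instance ι) (h : Node ι → ℕ) {S : Multiset (Node ι)} (hS : S ≠ 0) :
    ∃ N, IsMin I h S N := by
  obtain ⟨M, hM⟩ := Multiset.exists_mem_of_ne_zero hS
  obtain ⟨N, hN, hmin⟩ := WellFounded.has_min (measure (prio I h)).wf {N | N ∈ S} ⟨M, hM⟩
  exact ⟨N, hN, fun M hM => not_lt.1 (hmin M hM)⟩

theorem Step.potential_lt (hadm : Admissible I k h) {S S' : Multiset (Node ι)}
    (hs : Step I k h rule S S') (hS : Covering I k S) {π : ι → ℕ → Cell} (hπ : IsSolution I k π) :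
    potential I (sic I π) S' < potential I (sic I π) S := by
  obtain ⟨N, T, r, S₁, S₂, rfl, hmin, -, hr, -, h₁, h₂, rfl⟩ := hs
  have hN := hS.1 N (by simp)
  have hB := hmin.sic_le hadm hS hπ
  have e₁ := h₁.potential_le hN hB (violates_branches hr).1
  have e₂ := h₂.potential_le hN hB (violates_branches hr).2
  have pos : 0 < 3 ^ freedom I (sic I π) N := by positivity
  simp only [potential, Multiset.map_add, Multiset.sum_add, Multiset.map_cons,
    Multiset.sum_cons] at *
  omega

theorem searchCorrect_of_total (hadm : Admissible I k h)
    (htot : ∀ N : Node ι, N.Wf I → Conflicted k N.paths → ∃ r, Valid I k N r ∧ rule N r) :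
    SearchCorrect I k h rule := by
  refine ⟨exists_init I, fun S₀ h₀ => ⟨fun S hS N hN => ?_, fun ⟨π, hπ⟩ => ⟨fun S hS => ?_, ?_⟩⟩⟩
  · have hc := covering_of_reflTransGen h₀.covering hS
    exact ⟨⟨fun i => (hc.1 N hN.1.1 i).1.1, hN.2⟩, fun π hπ => hN.1.sic_le hadm hc hπ⟩
  · have hc := covering_of_reflTransGen h₀.covering hS
    obtain ⟨M, hM, -⟩ := hc.2 π hπ
    have hne : S ≠ 0 := by
      rintro rfl
      simp at hM
    refine ⟨hne, ?_⟩
    obtain ⟨N, hN⟩ := exists_isMin I h hne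
    by_cases hconf : Conflicted k N.paths
    · obtain ⟨T, hT⟩ := Multiset.exists_cons_of_mem hN.1
      obtain ⟨r, hr, hrule⟩ := htot N (hc.1 N hN.1) hconf
      obtain ⟨S₁, h₁⟩ := exists_child I N (branches I k N r).1.1 (branches I k N r).1.2
      obtain ⟨S₂, h₂⟩ := exists_child I N (branches I k N r).2.1 (branches I k N r).2.2
      exact Or.inr ⟨_, N, T, r, S₁, S₂, hT, hN, hconf, hr, hrule, h₁, h₂, rfl⟩
    · exact Or.inl ⟨N, hN, hconf⟩
  · rintro ⟨run, rfl, hrun⟩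
    have hc : ∀ n, Covering I k (run n) := fun n => by
      induction n with
      | zero => exact h₀.covering
      | succ n ih => exact (hrun n).covering ih
    -- The bound `sic I π` is fixed for the whole run, so an infinite run would give an infinite
    -- descent in `ℕ`.
    have hlt := fun n => (hrun n).potential_lt hadm (hc n) hπ
    obtain ⟨n, hn⟩ := WellFounded.not_rel_apply_succ (r := (· < ·))
      fun n => potential I (sic I π) (run n)
    exact hn (hlt n)

end Search

theorem exists_valid_rmRule {I : Instance ι} {k : ℕ} (mode : Mode) {N : Node ι}
    (hN : Conflicted k N.paths) : ∃ r, Valid I k N r ∧ rmRule I k mode N r := by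
  rcases hN with ⟨i, j, v, t, Δ, hc⟩ | ⟨i, j, u, v, t, hc⟩
  · by_cases hr : ∃ a b R rt k₁ k₂, RectOf I N i j v t Δ a b R rt k₁ k₂ ∧
      Valid I k N (.rect mode a b R rt k₁ k₂)
    · obtain ⟨a, b, R, rt, k₁, k₂, hr, hv⟩ := hr
      exact ⟨_, hv, rfl, i, j, v, t, Δ, hc, hr⟩
    · exact ⟨.vertex i j v t Δ, hc, hr⟩
  · exact ⟨.swap i j u v t, hc, trivial⟩

end KRobust

theorem theorem2 {ι : Type*} [Fintype ι] (I : KRobust.Instance ι) (k : ℕ)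
    (h : KRobust.Node ι → ℕ) (hadm : KRobust.Admissible I k h) :
    -- branching removes no solutions, and either branch is violated by the current path
    (∀ N : KRobust.Node ι, N.Wf I → ∀ r, KRobust.Valid I k N r →
      (∀ π, KRobust.IsSolution I k π → KRobust.Permits N.cons π →
        KRobust.Permits (N.cons ∪ (KRobust.branches I k N r).1.2) π ∨
        KRobust.Permits (N.cons ∪ (KRobust.branches I k N r).2.2) π) ∧
      KRobust.Violates (KRobust.branches I k N r).1.2 (KRobust.branches I k N r).1.1
        (N.paths (KRobust.branches I k N r).1.1) ∧
      KRobust.Violates (KRobust.branches I k N r).2.2 (KRobust.branches I k N r).2.1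
        (N.paths (KRobust.branches I k N r).2.1)) ∧
    -- K-CBSH-RM is complete and optimal
    (∀ mode : KRobust.Mode, KRobust.SearchCorrect I k h (KRobust.rmRule I k mode)) ∧
    -- and so is the search with any other rule for choosing among the valid resolutions
    (∀ rule : KRobust.Node ι → KRobust.Resolution ι → Prop,
      (∀ N : KRobust.Node ι, N.Wf I → KRobust.Conflicted k N.paths →
        ∃ r, KRobust.Valid I k N r ∧ rule N r) →
      KRobust.SearchCorrect I k h rule) := by
  refine ⟨fun N _ r hr => ⟨fun π hπ hN => KRobust.permits_branch hr hπ hN,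
    KRobust.violates_branches hr⟩, fun mode => ?_, fun rule => ?_⟩
  · exact KRobust.searchCorrect_of_total hadm fun _ _ hN => KRobust.exists_valid_rmRule mode hN
  · exact KRobust.searchCorrect_of_total hadm
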